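/- Let $\mathcal C$ be a left cancellative small category, identified with its set of morphisms: $xy$ is defined when the source of $x$ is the target of $y$, and $xy=xz$ implies $y=z$. Let $I_l$ be the left inverse hull of $\mathcal C$, that is, the inverse semigroup of partial bijections of $\mathcal C$ generated by the left multiplication maps $c\colon x\mapsto cx$, $c\in\mathcal C$. Let $E$ be its semilattice of idempotents, identified with subsets of $\mathcal C$ (an idempotent corresponds to its domain). Let $\Omega$ be the space, with the topology of pointwise convergence, of all semicharacters $\chi\colon E\to\{0,1\}$ (nonzero multiplicative maps, vanishing at the empty set if it is in $E$) such that $\chi(f)=\bigvee_{i=1}^n\chi(e_i)$ whenever $f,e_1,\dots,e_n\in E$ and $f=\bigcup_{i=1}^n e_i$. Let $\overline E$ be the family of all sets $\bigcup_{i=1}^n\bigl(e_i\setminus\bigcup_{j=1}^{k_i}f_{ij}\bigr)$ with $e_i,f_{ij}\in E$, $f_{ij}\subseteq e_i$; every $\chi\in\Omega$ extends to $\overline E$ by $\chi\bigl(\bigcup_i(e_i\setminus\bigcup_jf_{ij})\bigr)=\bigvee_i\bigl(\chi(e_i)\setminus\bigvee_j\chi(f_{ij})\bigr)$, computed in the Boolean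 algebra $\{0,1\}$. Let $\overline I_l=\{se : s\in I_l,\ e\in\overline E,\ e\le s^{-1}s\}$, an inverse semigroup, which acts on $\Omega$ by $(s\cdot\chi)(e)=\chi(s^{-1}es)$ when $\chi(s^{-1}s)=1$. Let $\mathcal G=\overline I_l\ltimes\Omega$ be the transformation groupoid of germs $[s,\chi]$ with $s\in\overline I_l$, $\chi\in\Omega$, $\chi(s^{-1}s)=1$, where $[s,\chi]=[t,\psi]$ if and only if $\chi=\psi$ and $se=te$ for some idempotent $e\in\overline I_l$ with $\chi(e)=1$. The source of $[s,\chi]$ is $\chi$, its target is $s\cdot\chi$, and the sets $\{[s,\chi] : \chi\in U\}$, for $s\in\overline I_l$ and $U$ an open subset of $\{\chi\in\Omega : \chi(s^{-1}s)=1\}$, form a basis of the topology of $\mathcal G$. For $c\in\mathcal C$ let $\chi_c\in\Omega$ be the principal character: $\chi_c(e)=1$ if and only if $cc^{-1}\le e$. Then the interior of the isotropy $\{g\in\mathcal G : \text{the source of } g \text{ equals its target}\}$ consists of exactly those germs $[s,\chi]\in\mathcal G$ for which there is an idempotent $e\in\overline I_l$ such that 1. $e\le s^{-1}s$; 2. $\chi(e)=1$;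 3. for each $c\in\operatorname{dom}(e)\subseteq\mathcal C$ there is an invertible morphism $u$ of $\mathcal C$ from the source of $c$ to itself such that $[s,\chi_c]=[cuc^{-1},\chi_c]$. This holds for every pair $(s,\chi)$ representing the germ. -/

import Mathlib

open CategoryTheory

universe v u w

/-! ## Partial bijections -/

namespace PBij

variable {α : Type w}

/-- The domain of a partial bijection. -/
def dom (s : α ≃. α) : Set α := {x | ∃ y, y ∈ s x}

/-- The idempotent partial bijection with domain `A`: the identity map of `A`. -/
noncomputable def idOn (A : Set α) : α ≃. α := by
  classical exact PEquiv.ofSet A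

open Classical in
/-- The partial bijection with graph `R`, see `mem_ofGraph`. -/
noncomputable def ofGraph (R : α → α → Prop) (h₁ : ∀ x y y', R x y → R x y' → y = y')
    (h₂ : ∀ x x' y, R x y → R x' y → x = x') : α ≃. α where
  toFun x := if h : ∃ y, R x y then some h.choose else none
  invFun y := if h : ∃ x, R x y then some h.choose else none
  inv x y := by
    have e1 : x ∈ (if h : ∃ x, R x y then some h.choose else none) ↔ R x y := by
      split_ifs with h
      · rw [Option.mem_some_iff]
        constructor
        · rintro rfl
          exact h.choose_spec
        · intro hx
          exact h₂ _ _ _ h.choose_spec hx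
      · constructor
        · intro hx
          cases hx
        · intro hx
          exact absurd ⟨x, hx⟩ h
    have e2 : y ∈ (if h : ∃ y, R x y then some h.choose else none) ↔ R x y := by
      split_ifs with h
      · rw [Option.mem_some_iff]
        constructor
        · rintro rfl
          exact h.choose_spec
        · intro hy
          exact h₁ _ _ _ h.choose_spec hy
      · constructor
        · intro hy
          cases hy
        · intro hy
          exact absurd ⟨y, hy⟩ h
    exact e1.trans e2.symm

theorem mem_ofGraph {R : α → α → Prop} {h₁ : ∀ x y y', R x y → R x y' → y = y'}
    {h₂ : ∀ x x' y, R x y → R x' y → x = x'} {x y : α} :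
    y ∈ ofGraph R h₁ h₂ x ↔ R x y := by
  classical
  change y ∈ (if h : ∃ y, R x y then some h.choose else none) ↔ R x y
  split_ifs with h
  · rw [Option.mem_some_iff]
    constructor
    · rintro rfl
      exact h.choose_spec
    · intro hy
      exact h₁ _ _ _ h.choose_spec hy
  · constructor
    · intro hy
      cases hy
    · intro hy
      exact absurd ⟨y, hy⟩ h

/-- The product `s t` in the symmetric inverse monoid: first `t`, then `s`. -/
def mul (s t : α ≃. α) : α ≃. α := t.trans s

/-- `s⁻¹(A)`, the set of all `x` in the domain of `s` with `s x ∈ A`. Under the identification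
of idempotents with subsets it is the idempotent `s⁻¹ A s`, see `mul_idOn_mul`. -/
def preimage (s : α ≃. α) (A : Set α) : Set α := {x | ∃ y, y ∈ s x ∧ y ∈ A}

theorem mem_idOn {A : Set α} {x y : α} : y ∈ idOn A x ↔ x ∈ A ∧ x = y := by
  classical
  unfold idOn
  rw [PEquiv.mem_ofSet_iff]
  constructor
  · rintro ⟨h, h'⟩
    subst h
    exact ⟨h', rfl⟩
  · rintro ⟨h, h'⟩
    subst h'
    exact ⟨rfl, h⟩

theorem mem_mul {s t : α ≃. α} {x z : α} : z ∈ mul s t x ↔ ∃ y, y ∈ t x ∧ z ∈ s y :=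
  PEquiv.mem_trans _ _ _ _

theorem ext_mem {s t : α ≃. α} (h : ∀ x y, y ∈ s x ↔ y ∈ t x) : s = t := by
  apply PEquiv.ext
  intro x
  apply Option.ext
  intro y
  exact h x y

theorem mem_unique {s : α ≃. α} {x y z : α} (h : y ∈ s x) (h' : z ∈ s x) : y = z :=
  Option.mem_unique h h'

theorem mem_unique_left {s : α ≃. α} {x y z : α} (h : z ∈ s x) (h' : z ∈ s y) : x = y :=
  s.inj h h'

theorem mem_symm {s : α ≃. α} {x y : α} : x ∈ s.symm y ↔ y ∈ s x := s.mem_iff_mem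

theorem dom_idOn (A : Set α) : dom (idOn A) = A := by
  ext x
  constructor
  · rintro ⟨y, h⟩
    exact (mem_idOn.1 h).1
  · intro h
    exact ⟨x, mem_idOn.2 ⟨h, rfl⟩⟩

theorem idOn_mul_idOn (A B : Set α) : mul (idOn A) (idOn B) = idOn (A ∩ B) := by
  apply ext_mem
  intro x y
  simp only [mem_mul, mem_idOn, Set.mem_inter_iff]
  constructor
  · rintro ⟨z, ⟨h, rfl⟩, h', rfl⟩
    exact ⟨⟨h', h⟩, rfl⟩
  · rintro ⟨⟨h, h'⟩, rfl⟩
    exact ⟨x, ⟨h', rfl⟩, h, rfl⟩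

/-- `s⁻¹ s` is the domain of `s`. -/
theorem symm_mul (s : α ≃. α) : mul s.symm s = idOn (dom s) := by
  apply ext_mem
  intro x y
  simp only [mem_mul, mem_idOn, mem_symm, dom, Set.mem_ofPred_eq]
  constructor
  · rintro ⟨z, h, h'⟩
    exact ⟨⟨z, h⟩, mem_unique_left h h'⟩
  · rintro ⟨⟨z, h⟩, rfl⟩
    exact ⟨z, h, h⟩

theorem mul_idOn_mul (s : α ≃. α) (A : Set α) :
    mul s.symm (mul (idOn A) s) = idOn (preimage s A) := by
  apply ext_mem
  intro x y
  simp only [mem_mul, mem_idOn, mem_symm, preimage, Set.mem_ofPred_eq]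
  constructor
  · rintro ⟨z, ⟨z', h, hA, rfl⟩, h'⟩
    exact ⟨⟨z', h, hA⟩, mem_unique_left h h'⟩
  · rintro ⟨⟨z, h, hA⟩, rfl⟩
    exact ⟨z, ⟨z, h, hA, rfl⟩, h⟩

/-- Every idempotent partial bijection is the identity map of its domain. -/
theorem eq_idOn_of_mul_self {e : α ≃. α} (h : mul e e = e) : e = idOn (dom e) := by
  have key : ∀ x y, y ∈ e x → x = y := by
    intro x y hxy
    have h1 : y ∈ mul e e x := by rw [h]; exact hxy
    obtain ⟨z, hz, hz'⟩ := mem_mul.1 h1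
    have := mem_unique hz hxy
    subst this
    exact mem_unique_left hxy hz'
  apply ext_mem
  intro x y
  rw [mem_idOn]
  constructor
  · intro hxy
    exact ⟨⟨y, hxy⟩, key x y hxy⟩
  · rintro ⟨⟨z, hz⟩, rfl⟩
    have := key x z hz
    subst this
    exact hz

theorem dom_mul_idOn {s : α ≃. α} {A : Set α} (h : A ⊆ dom s) :
    dom (mul s (idOn A)) = A := by
  ext x
  constructor
  · rintro ⟨y, hy⟩
    obtain ⟨z, hz, _⟩ := mem_mul.1 hy
    exact (mem_idOn.1 hz).1
  · intro hx
    obtain ⟨y, hy⟩ := h hx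
    exact ⟨y, mem_mul.2 ⟨x, mem_idOn.2 ⟨hx, rfl⟩, hy⟩⟩

theorem preimage_mul_idOn (s : α ≃. α) (A B : Set α) :
    preimage (mul s (idOn A)) B = A ∩ preimage s B := by
  ext x
  constructor
  · rintro ⟨y, hy, hB⟩
    obtain ⟨z, hz, hz'⟩ := mem_mul.1 hy
    obtain ⟨hA, rfl⟩ := mem_idOn.1 hz
    exact ⟨hA, y, hz', hB⟩
  · rintro ⟨hA, y, hy, hB⟩
    exact ⟨y, mem_mul.2 ⟨x, mem_idOn.2 ⟨hA, rfl⟩, hy⟩, hB⟩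

theorem preimage_inter_dom {s t e : α ≃. α} (he : mul e e = e) (h : mul s e = mul t e)
    (A : Set α) : preimage s A ∩ dom e ⊆ preimage t A := by
  rintro x ⟨⟨y, hy, hA⟩, hx⟩
  rw [eq_idOn_of_mul_self he] at h
  have : y ∈ mul s (idOn (dom e)) x := mem_mul.2 ⟨x, mem_idOn.2 ⟨hx, rfl⟩, hy⟩
  rw [h] at this
  obtain ⟨z, hz, hz'⟩ := mem_mul.1 this
  obtain ⟨_, rfl⟩ := mem_idOn.1 hz
  exact ⟨y, hz', hA⟩

end PBij

/-! ## Left cancellative small categories and their inverse hulls -/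

/-- Left cancellation: `x y = x z` implies `y = z`, where `x y` denotes the composite "first `y`,
then `x`", which is written `y ≫ x` in Lean. -/
class LeftCancellativeCategory (C : Type u) [Category.{v} C] : Prop where
  left_cancel : ∀ {X Y Z : C} (x : Y ⟶ Z) (y z : X ⟶ Y), y ≫ x = z ≫ x → y = z

namespace LCSC

open PBij

section

variable (C : Type u) [Category.{v} C]

/-- The set of all morphisms of `C`. The source of `c` is `c.left`, its target is `c.right`. -/
abbrev Mor : Type (max u v) := Arrow C

end

section

variable {C : Type u} [Category.{v} C]

theorem mk_eq_mk {X X' Y Y' : C} {x : X ⟶ Y} {x' : X' ⟶ Y'}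
    (h : Arrow.mk x = Arrow.mk x') : ∃ (hX : X = X') (hY : Y = Y'),
      x ≫ eqToHom hY = eqToHom hX ≫ x' := by
  have h1 : X = X' := congrArg (fun a : Arrow C => a.left) h
  have h2 : Y = Y' := congrArg (fun a : Arrow C => a.right) h
  subst h1
  subst h2
  refine ⟨rfl, rfl, ?_⟩
  have := Arrow.mk_injective _ _ h
  simp [this]

variable [LeftCancellativeCategory C]

/-- Left multiplication by `c` as a partial bijection of the set of morphisms: it is defined at
those `x` whose target is the source of `c`, and sends `x` to `c x`. -/
noncomputable def leftMul {Y Z : C} (c : Y ⟶ Z) : Mor C ≃. Mor C :=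
  ofGraph (fun a b => ∃ (X : C) (x : X ⟶ Y), a = Arrow.mk x ∧ b = Arrow.mk (x ≫ c))
    (by
      rintro a b b' ⟨X, x, rfl, rfl⟩ ⟨X', x', h, rfl⟩
      obtain ⟨hX, hY, hxy⟩ := mk_eq_mk h
      subst hX
      simp only [eqToHom_refl, Category.comp_id, Category.id_comp] at hxy
      rw [hxy])
    (by
      rintro a a' b ⟨X, x, rfl, rfl⟩ ⟨X', x', rfl, h⟩
      obtain ⟨hX, hY, hxy⟩ := mk_eq_mk h
      subst hX
      simp only [eqToHom_refl, Category.comp_id, Category.id_comp] at hxy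
      rw [LeftCancellativeCategory.left_cancel c _ _ hxy])

theorem mem_leftMul {Y Z : C} {c : Y ⟶ Z} {a b : Mor C} :
    b ∈ leftMul c a ↔ ∃ (X : C) (x : X ⟶ Y), a = Arrow.mk x ∧ b = Arrow.mk (x ≫ c) :=
  mem_ofGraph

end

section

variable (C : Type u) [Category.{v} C] [LeftCancellativeCategory C]

/-- The left inverse hull `I_l`: the inverse semigroup of partial bijections that is generated by
the left multiplication maps. -/
inductive InverseHull : (Mor C ≃. Mor C) → Prop
  | leftMul {Y Z : C} (c : Y ⟶ Z) : InverseHull (leftMul c)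
  | mul {s t : Mor C ≃. Mor C} : InverseHull s → InverseHull t → InverseHull (mul s t)
  | symm {s : Mor C ≃. Mor C} : InverseHull s → InverseHull s.symm

/-- The semilattice `E` of idempotents of `I_l`. Idempotents are identified with subsets of the
set of morphisms, so that the product is the intersection and the order is inclusion. -/
@[ext]
structure E : Type (max u v) where
  /-- The underlying set. -/
  carrier : Set (Mor C)
  mem_hull : InverseHull C (idOn carrier)

end

section

variable {C : Type u} [Category.{v} C] [LeftCancellativeCategory C]

instance : CoeOut (E C) (Set (Mor C)) := ⟨E.carrier⟩

namespace E

/-- The product of two idempotents. -/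
def inter (e f : E C) : E C :=
  ⟨(e : Set (Mor C)) ∩ f, by rw [← idOn_mul_idOn]; exact InverseHull.mul e.2 f.2⟩

end E

/-- `s⁻¹ s` for `s ∈ I_l`. -/
def domE {s : Mor C ≃. Mor C} (hs : InverseHull C s) : E C :=
  ⟨dom s, by rw [← symm_mul]; exact InverseHull.mul (InverseHull.symm hs) hs⟩

/-- `s⁻¹ e s` for `s ∈ I_l` and `e ∈ E`. -/
def conjE {s : Mor C ≃. Mor C} (hs : InverseHull C s) (e : E C) : E C :=
  ⟨preimage s e, by
    rw [← mul_idOn_mul]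
    exact InverseHull.mul (InverseHull.symm hs) (InverseHull.mul e.2 hs)⟩

end

section

variable (C : Type u) [Category.{v} C] [LeftCancellativeCategory C]

/-- The space `Ω` of all semicharacters `χ : E → {0, 1}` (nonzero multiplicative maps) that
preserve the finite joins in the power set that exist in `E`. The empty join is included: `χ`
vanishes at the zero element of the inverse hull, if there is one. -/
@[ext]
structure Omega : Type (max u v) where
  /-- The underlying map, with `true` for `1` and `false` for `0`. -/
  toFun : E C → Bool
  nonzero : ∃ e, toFun e = true
  map_inter : ∀ e f : E C, toFun (e.inter f) = (toFun e && toFun f)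
  map_join : ∀ (f : E C) (l : List (E C)), (f : Set (Mor C)) = ⋃ e ∈ l, (e : Set (Mor C)) →
    (toFun f = true ↔ ∃ e ∈ l, toFun e = true)

/-- `Ω` carries the topology of pointwise convergence. -/
instance : TopologicalSpace (Omega C) :=
  TopologicalSpace.induced Omega.toFun inferInstance

/-- A formal expression `⋁ᵢ (eᵢ ∖ ⋁ⱼ fᵢⱼ)` with `eᵢ, fᵢⱼ ∈ E` and `fᵢⱼ ≤ eᵢ`, given by
the list of all pairs `(eᵢ, (fᵢⱼ)ⱼ)`. -/
abbrev BoolExpr : Type (max u v) :=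
  {l : List (E C × List (E C)) // ∀ p ∈ l, ∀ f ∈ p.2, (f : Set (Mor C)) ⊆ p.1}

end

section

variable {C : Type u} [Category.{v} C] [LeftCancellativeCategory C]

/-- The set `⋃ᵢ (eᵢ ∖ ⋃ⱼ fᵢⱼ)`. -/
def BoolExpr.toSet (l : BoolExpr C) : Set (Mor C) :=
  {x | ∃ p ∈ l.1, x ∈ (p.1 : Set (Mor C)) ∧ ∀ f ∈ p.2, x ∉ (f : Set (Mor C))}

/-- The value `⋁ᵢ (χ(eᵢ) ∖ ⋁ⱼ χ(fᵢⱼ))`, as a proposition. -/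
def BoolExpr.Holds (l : BoolExpr C) (χ : Omega C) : Prop :=
  ∃ p ∈ l.1, χ.toFun p.1 = true ∧ ∀ f ∈ p.2, χ.toFun f = false

end

section

variable (C : Type u) [Category.{v} C] [LeftCancellativeCategory C]

/-- The Boolean closure of `E`. -/
def EBar : Set (Set (Mor C)) := {A | ∃ l : BoolExpr C, A = l.toSet}

/-- The enlarged inverse hull `{s e | s ∈ I_l, e in the Boolean closure of E, e ≤ s⁻¹ s}`. -/
def IBar : Set (Mor C ≃. Mor C) :=
  {t | ∃ s, InverseHull C s ∧ ∃ A ∈ EBar C, A ⊆ dom s ∧ t = mul s (idOn A)}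

end

section

variable {C : Type u} [Category.{v} C] [LeftCancellativeCategory C]

/-- `χ.ev A` says that the extension of `χ ∈ Ω` to the Boolean closure of `E` takes the value `1`
at `A`. By `ev_toSet` the value does not depend on the expression chosen for `A`. -/
def Omega.ev (χ : Omega C) (A : Set (Mor C)) : Prop := ∃ l : BoolExpr C, A = l.toSet ∧ l.Holds χ

theorem Omega.inter_iff (χ : Omega C) (e f : E C) :
    χ.toFun (e.inter f) = true ↔ χ.toFun e = true ∧ χ.toFun f = true := by
  rw [χ.map_inter e f, Bool.and_eq_true]

theorem Omega.exists_of_subset (χ : Omega C) (g : E C) (hg : χ.toFun g = true) (H : List (E C))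
    (h : ∀ x ∈ (g : Set (Mor C)), ∃ e ∈ H, x ∈ (e : Set (Mor C))) :
    ∃ e ∈ H, χ.toFun e = true := by
  have hu : (g : Set (Mor C)) = ⋃ e ∈ H.map g.inter, (e : Set (Mor C)) := by
    ext x
    simp only [Set.mem_iUnion, List.mem_map, exists_prop]
    constructor
    · intro hx
      obtain ⟨e, he, hxe⟩ := h x hx
      exact ⟨_, ⟨e, he, rfl⟩, hx, hxe⟩
    · rintro ⟨_, ⟨e, _, rfl⟩, hx⟩
      exact hx.1
  obtain ⟨e', he', hχ⟩ := (χ.map_join g _ hu).1 hg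
  obtain ⟨e, he, rfl⟩ := List.mem_map.1 he'
  exact ⟨e, he, ((χ.inter_iff g e).1 hχ).2⟩

theorem Omega.mono (χ : Omega C) {e f : E C} (h : (e : Set (Mor C)) ⊆ f)
    (he : χ.toFun e = true) : χ.toFun f = true := by
  obtain ⟨e', he', hχ⟩ := χ.exists_of_subset e he [f] (fun x hx => ⟨f, by simp, h hx⟩)
  rw [List.mem_singleton] at he'
  rwa [he'] at hχ

theorem Omega.refine_list (χ : Omega C) (l : List (E C × List (E C)))
    (hl : ¬ ∃ p ∈ l, χ.toFun p.1 = true ∧ ∀ f ∈ p.2, χ.toFun f = false) (e : E C) (he : χ.toFun e = true) :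
    ∃ (g : E C) (H : List (E C)), (g : Set (Mor C)) ⊆ e ∧ χ.toFun g = true ∧
      (∀ h ∈ H, χ.toFun h = false) ∧
      ∀ x ∈ (g : Set (Mor C)), (∃ p ∈ l, x ∈ (p.1 : Set (Mor C)) ∧
        ∀ f ∈ p.2, x ∉ (f : Set (Mor C))) → ∃ h ∈ H, x ∈ (h : Set (Mor C)) := by
  induction l with
  | nil => exact ⟨e, [], subset_rfl, he, by simp, by simp⟩
  | cons p l ih =>
    obtain ⟨g, H, hge, hg, hH, hx⟩ := ih (fun ⟨q, hq, hq'⟩ => hl ⟨q, List.mem_cons_of_mem _ hq, hq'⟩)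
    by_cases hp : χ.toFun p.1 = true
    · have : ∃ f ∈ p.2, χ.toFun f = true := by
        by_contra hcon
        refine hl ⟨p, List.mem_cons_self, hp, fun f hf => ?_⟩
        rw [← Bool.not_eq_true]
        exact fun hf' => hcon ⟨f, hf, hf'⟩
      obtain ⟨f, hf, hχf⟩ := this
      refine ⟨g.inter f, H, fun x hx => hge hx.1, (χ.inter_iff g f).2 ⟨hg, hχf⟩, hH, ?_⟩
      rintro x hxg ⟨q, hq, hq'⟩
      rcases List.mem_cons.1 hq with rfl | hq
      · exact absurd hxg.2 (hq'.2 f hf)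
      · exact hx x hxg.1 ⟨q, hq, hq'⟩
    · refine ⟨g, p.1 :: H, hge, hg, ?_, ?_⟩
      · intro h hh
        rcases List.mem_cons.1 hh with rfl | hh
        · simpa using hp
        · exact hH h hh
      · rintro x hxg ⟨q, hq, hq'⟩
        rcases List.mem_cons.1 hq with rfl | hq
        · exact ⟨_, List.mem_cons_self, hq'.1⟩
        · obtain ⟨h, hh, hh'⟩ := hx x hxg ⟨q, hq, hq'⟩
          exact ⟨h, List.mem_cons_of_mem _ hh, hh'⟩

theorem BoolExpr.holds_mono {l l' : BoolExpr C} {χ : Omega C} (h : l.toSet ⊆ l'.toSet)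
    (hl : l.Holds χ) : l'.Holds χ := by
  obtain ⟨p, hp, hp1, hp2⟩ := hl
  by_contra hcon
  obtain ⟨g, H, hge, hg, hH, hx⟩ := χ.refine_list l'.1 hcon p.1 hp1
  have := χ.exists_of_subset g hg (p.2 ++ H) (by
    intro x hxg
    by_cases hxf : ∃ f ∈ p.2, x ∈ (f : Set (Mor C))
    · obtain ⟨f, hf, hf'⟩ := hxf
      exact ⟨f, List.mem_append_left _ hf, hf'⟩
    · have hxl : x ∈ l.toSet := ⟨p, hp, hge hxg, fun f hf hf' => hxf ⟨f, hf, hf'⟩⟩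
      obtain ⟨h', hh, hh'⟩ := hx x hxg (h hxl)
      exact ⟨h', List.mem_append_right _ hh, hh'⟩)
  obtain ⟨e, he, hχ⟩ := this
  rcases List.mem_append.1 he with he | he
  · rw [hp2 e he] at hχ
    cases hχ
  · rw [hH e he] at hχ
    cases hχ

theorem Omega.ev_toSet (χ : Omega C) (l : BoolExpr C) : χ.ev l.toSet ↔ l.Holds χ := by
  constructor
  · rintro ⟨l', h, hl'⟩
    exact BoolExpr.holds_mono h.ge hl'
  · intro h
    exact ⟨l, rfl, h⟩

/-- An element of `E` as an element of the Boolean closure. -/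
def BoolExpr.single (e : E C) : BoolExpr C :=
  ⟨[(e, [])], by
    intro p hp f hf
    rw [List.mem_singleton] at hp
    subst hp
    simp at hf⟩

theorem BoolExpr.toSet_single (e : E C) : (BoolExpr.single e).toSet = e := by
  ext x
  simp [BoolExpr.toSet, BoolExpr.single]

theorem BoolExpr.holds_single (e : E C) (χ : Omega C) :
    (BoolExpr.single e).Holds χ ↔ χ.toFun e = true := by
  simp [BoolExpr.Holds, BoolExpr.single]

/-- The extension of `χ` to the Boolean closure extends `χ`. -/
theorem Omega.ev_coe (χ : Omega C) (e : E C) : χ.ev (e : Set (Mor C)) ↔ χ.toFun e = true := by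
  rw [← BoolExpr.holds_single, ← χ.ev_toSet, BoolExpr.toSet_single]

theorem E.mem_EBar (e : E C) : (e : Set (Mor C)) ∈ EBar C :=
  ⟨BoolExpr.single e, (BoolExpr.toSet_single e).symm⟩

/-- The intersection of two elements of the Boolean closure. -/
def BoolExpr.inter (l l' : BoolExpr C) : BoolExpr C :=
  ⟨(l.1 ×ˢ l'.1).map fun q => (q.1.1.inter q.2.1,
      q.1.2.map (fun f => f.inter q.2.1) ++ q.2.2.map (fun f => q.1.1.inter f)), by
    intro p hp f hf
    obtain ⟨q, hq, rfl⟩ := List.mem_map.1 hp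
    obtain ⟨hq1, hq2⟩ := List.mem_product.1 hq
    rcases List.mem_append.1 hf with hf | hf
    · obtain ⟨g, hg, rfl⟩ := List.mem_map.1 hf
      exact fun x hx => ⟨l.2 _ hq1 _ hg hx.1, hx.2⟩
    · obtain ⟨g, hg, rfl⟩ := List.mem_map.1 hf
      exact fun x hx => ⟨hx.1, l'.2 _ hq2 _ hg hx.2⟩⟩

theorem BoolExpr.toSet_inter (l l' : BoolExpr C) :
    (l.inter l').toSet = l.toSet ∩ l'.toSet := by
  ext x
  constructor
  · rintro ⟨p, hp, hx, hxf⟩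
    obtain ⟨q, hq, rfl⟩ := List.mem_map.1 hp
    obtain ⟨hq1, hq2⟩ := List.mem_product.1 hq
    refine ⟨⟨q.1, hq1, hx.1, fun f hf hf' => ?_⟩, ⟨q.2, hq2, hx.2, fun f hf hf' => ?_⟩⟩
    · exact hxf _ (List.mem_append_left _ (List.mem_map_of_mem hf)) ⟨hf', hx.2⟩
    · exact hxf _ (List.mem_append_right _ (List.mem_map_of_mem hf)) ⟨hx.1, hf'⟩
  · rintro ⟨⟨p, hp, hx, hxf⟩, ⟨p', hp', hx', hxf'⟩⟩
    refine ⟨_, List.mem_map_of_mem (List.mem_product.2 ⟨hp, hp'⟩ : (p, p') ∈ l.1 ×ˢ l'.1),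
      ⟨hx, hx'⟩, fun f hf hxf2 => ?_⟩
    rcases List.mem_append.1 hf with hf | hf
    · obtain ⟨g, hg, rfl⟩ := List.mem_map.1 hf
      exact hxf g hg hxf2.1
    · obtain ⟨g, hg, rfl⟩ := List.mem_map.1 hf
      exact hxf' g hg hxf2.2

theorem BoolExpr.holds_inter (l l' : BoolExpr C) (χ : Omega C) :
    (l.inter l').Holds χ ↔ l.Holds χ ∧ l'.Holds χ := by
  constructor
  · intro h
    have h1 : (l.inter l').toSet ⊆ l.toSet := by
      rw [BoolExpr.toSet_inter]
      exact Set.inter_subset_left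
    have h2 : (l.inter l').toSet ⊆ l'.toSet := by
      rw [BoolExpr.toSet_inter]
      exact Set.inter_subset_right
    exact ⟨BoolExpr.holds_mono h1 h, BoolExpr.holds_mono h2 h⟩
  · rintro ⟨⟨p, hp, hx, hxf⟩, ⟨p', hp', hx', hxf'⟩⟩
    refine ⟨_, List.mem_map_of_mem (List.mem_product.2 ⟨hp, hp'⟩ : (p, p') ∈ l.1 ×ˢ l'.1),
      (χ.inter_iff _ _).2 ⟨hx, hx'⟩, fun f hf => ?_⟩
    rcases List.mem_append.1 hf with hf | hf
    · obtain ⟨g, hg, rfl⟩ := List.mem_map.1 hf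
      rw [χ.map_inter, hxf g hg, Bool.false_and]
    · obtain ⟨g, hg, rfl⟩ := List.mem_map.1 hf
      rw [χ.map_inter, hxf' g hg, Bool.and_false]

theorem EBar_inter {A B : Set (Mor C)} (hA : A ∈ EBar C) (hB : B ∈ EBar C) : A ∩ B ∈ EBar C := by
  obtain ⟨l, rfl⟩ := hA
  obtain ⟨l', rfl⟩ := hB
  exact ⟨l.inter l', (BoolExpr.toSet_inter l l').symm⟩

theorem Omega.ev_inter (χ : Omega C) {A B : Set (Mor C)} (hA : A ∈ EBar C) (hB : B ∈ EBar C) :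
    χ.ev (A ∩ B) ↔ χ.ev A ∧ χ.ev B := by
  obtain ⟨l, rfl⟩ := hA
  obtain ⟨l', rfl⟩ := hB
  rw [← BoolExpr.toSet_inter, ev_toSet, ev_toSet, ev_toSet, BoolExpr.holds_inter]

theorem IBar_of_hull {s : Mor C ≃. Mor C} (hs : InverseHull C s) : s ∈ IBar C := by
  refine ⟨s, hs, dom s, (domE hs).mem_EBar, subset_rfl, ?_⟩
  apply ext_mem
  intro x y
  rw [mem_mul]
  constructor
  · intro h
    exact ⟨x, mem_idOn.2 ⟨⟨y, h⟩, rfl⟩, h⟩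
  · rintro ⟨z, hz, hz'⟩
    obtain ⟨_, rfl⟩ := mem_idOn.1 hz
    exact hz'

theorem IBar.dom_mem {s : Mor C ≃. Mor C} (hs : s ∈ IBar C) : dom s ∈ EBar C := by
  obtain ⟨s₀, hs₀, A, hA, hAs, rfl⟩ := hs
  rwa [dom_mul_idOn hAs]

theorem IBar.preimage_mem {s : Mor C ≃. Mor C} (hs : s ∈ IBar C) (e : E C) :
    preimage s e ∈ EBar C := by
  obtain ⟨s₀, hs₀, A, hA, hAs, rfl⟩ := hs
  rw [preimage_mul_idOn]
  exact EBar_inter hA (conjE hs₀ e).mem_EBar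

/-- The domain `{χ ∈ Ω | χ(s⁻¹ s) = 1}` of the action of `s` on `Ω`. -/
def D (s : IBar C) : Set (Omega C) := {χ | χ.ev (dom s.1)}

open Classical in
/-- The action on `Ω`: `(s · χ)(e) = χ(s⁻¹ e s)`. -/
noncomputable def act (s : IBar C) (χ : Omega C) (h : χ ∈ D s) : Omega C :=
  have H : (∃ e : E C, decide (χ.ev (preimage s.1 e)) = true) ∧
      (∀ e f : E C, decide (χ.ev (preimage s.1 (e.inter f))) =
        (decide (χ.ev (preimage s.1 e)) && decide (χ.ev (preimage s.1 f)))) ∧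
      (∀ (f : E C) (l : List (E C)), (f : Set (Mor C)) = ⋃ e ∈ l, (e : Set (Mor C)) →
        (decide (χ.ev (preimage s.1 f)) = true ↔
          ∃ e ∈ l, decide (χ.ev (preimage s.1 e)) = true)) := by
    obtain ⟨s, s₀, hs₀, A, hA, hAs, rfl⟩ := s
    change χ.ev (dom (mul s₀ (idOn A))) at h
    rw [dom_mul_idOn hAs] at h
    have key : ∀ e : E C, χ.ev (preimage (mul s₀ (idOn A)) e) ↔ χ.toFun (conjE hs₀ e) = true := by
      intro e
      have h1 := χ.ev_inter hA (conjE hs₀ e).mem_EBar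
      rw [χ.ev_coe] at h1
      rw [preimage_mul_idOn]
      exact h1.trans (and_iff_right h)
    have key' : ∀ e : E C, decide (χ.ev (preimage (mul s₀ (idOn A)) e)) =
        χ.toFun (conjE hs₀ e) := by
      intro e
      rw [Bool.eq_iff_iff, decide_eq_true_iff, key e]
    simp only [key']
    refine ⟨⟨domE (InverseHull.symm hs₀), ?_⟩, ?_, ?_⟩
    · rw [← χ.ev_coe]
      have hE : ((conjE hs₀ (domE (InverseHull.symm hs₀)) : E C) : Set (Mor C)) = dom s₀ := by
        ext x
        constructor
        · rintro ⟨y, hy, _⟩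
          exact ⟨y, hy⟩
        · rintro ⟨y, hy⟩
          exact ⟨y, hy, x, mem_symm.2 hy⟩
      rw [hE]
      have : χ.ev (A ∩ dom s₀) := by rwa [Set.inter_eq_left.2 hAs]
      exact ((χ.ev_inter hA (domE hs₀).mem_EBar).1 this).2
    · intro e f
      rw [← χ.map_inter]
      congr 1
      apply E.ext
      ext x
      constructor
      · rintro ⟨y, hy, he, hf⟩
        exact ⟨⟨y, hy, he⟩, ⟨y, hy, hf⟩⟩
      · rintro ⟨⟨y, hy, he⟩, ⟨z, hz, hf⟩⟩
        obtain rfl := mem_unique hy hz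
        exact ⟨y, hy, he, hf⟩
    · intro f l hfl
      have := χ.map_join (conjE hs₀ f) (l.map (conjE hs₀)) (by
        ext x
        simp only [Set.mem_iUnion, List.mem_map, exists_prop]
        constructor
        · rintro ⟨y, hy, hyf⟩
          rw [hfl] at hyf
          simp only [Set.mem_iUnion, exists_prop] at hyf
          obtain ⟨e, he, hye⟩ := hyf
          exact ⟨_, ⟨e, he, rfl⟩, y, hy, hye⟩
        · rintro ⟨_, ⟨e, he, rfl⟩, y, hy, hye⟩
          refine ⟨y, hy, ?_⟩
          rw [hfl]
          simp only [Set.mem_iUnion, exists_prop]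
          exact ⟨e, he, hye⟩)
      rw [this]
      constructor
      · rintro ⟨_, he', hχ⟩
        obtain ⟨e, he, rfl⟩ := List.mem_map.1 he'
        exact ⟨e, he, hχ⟩
      · rintro ⟨e, he, hχ⟩
        exact ⟨_, List.mem_map_of_mem he, hχ⟩
  ⟨fun e => decide (χ.ev (preimage s.1 e)), H.1, H.2.1, H.2.2⟩

/-! ## The transformation groupoid -/

/-- `e` is an idempotent of the enlarged inverse hull. -/
def IsIdem (e : IBar C) : Prop := mul e.1 e.1 = e.1

theorem IsIdem.inter {e f : IBar C} (he : IsIdem e) (hf : IsIdem f) :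
    ∃ g : IBar C, IsIdem g ∧ g.1 = mul e.1 f.1 ∧ dom g.1 = dom e.1 ∩ dom f.1 := by
  have he' := eq_idOn_of_mul_self he
  have hf' := eq_idOn_of_mul_self hf
  have hef : mul e.1 f.1 = idOn (dom e.1 ∩ dom f.1) := by
    conv_lhs => rw [he', hf']
    exact idOn_mul_idOn _ _
  obtain ⟨s, hs, A, hA, hAs, hfs⟩ := f.2
  refine ⟨⟨idOn (dom e.1 ∩ dom f.1), s, hs, dom e.1 ∩ dom f.1,
    EBar_inter (IBar.dom_mem e.2) (IBar.dom_mem f.2), ?_, ?_⟩, ?_, hef.symm, dom_idOn _⟩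
  · intro x hx
    have := hx.2
    rw [hfs, dom_mul_idOn hAs] at this
    exact hAs this
  · apply ext_mem
    intro x y
    simp only [mem_mul, mem_idOn]
    have key : x ∈ dom f.1 → (y ∈ s x ↔ x = y) := by
      intro hx
      have hxA : x ∈ A := by rwa [hfs, dom_mul_idOn hAs] at hx
      have h1 : y ∈ f.1 x ↔ y ∈ s x := by
        rw [hfs, mem_mul]
        constructor
        · rintro ⟨z, hz, hz'⟩
          obtain ⟨_, rfl⟩ := mem_idOn.1 hz
          exact hz'
        · intro h
          exact ⟨x, mem_idOn.2 ⟨hxA, rfl⟩, h⟩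
      rw [← h1, hf', mem_idOn]
      exact and_iff_right hx
    constructor
    · rintro ⟨hx, rfl⟩
      exact ⟨x, ⟨hx, rfl⟩, (key hx.2).2 rfl⟩
    · rintro ⟨z, ⟨hx, rfl⟩, hy⟩
      exact ⟨hx, (key hx.2).1 hy⟩
  · change mul (idOn _) (idOn _) = idOn _
    rw [idOn_mul_idOn, Set.inter_self]

end

section

variable (C : Type u) [Category.{v} C] [LeftCancellativeCategory C]

/-- The set of all pairs `(s, χ)` with `χ(s⁻¹ s) = 1`. -/
def Pair : Type (max u v) := {p : IBar C × Omega C // p.2 ∈ D p.1}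

/-- Two pairs `(s, χ)` and `(t, ψ)` have the same germ if `χ = ψ` and `s e = t e` for some
idempotent `e` with `χ(e) = 1`. -/
def germSetoid : Setoid (Pair C) where
  r p q := p.1.2 = q.1.2 ∧
    ∃ e : IBar C, IsIdem e ∧ p.1.2.ev (dom e.1) ∧ mul p.1.1.1 e.1 = mul q.1.1.1 e.1
  iseqv := by
    constructor
    · rintro ⟨⟨s, χ⟩, h⟩
      refine ⟨rfl, ⟨idOn (dom s.1), ?_⟩, ?_, ?_, rfl⟩
      · obtain ⟨s, s₀, hs₀, A, hA, hAs, rfl⟩ := s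
        rw [dom_mul_idOn hAs]
        refine ⟨mul s₀.symm s₀, InverseHull.mul (InverseHull.symm hs₀) hs₀, A, hA, ?_, ?_⟩
        · rwa [symm_mul, dom_idOn]
        · rw [symm_mul, idOn_mul_idOn, Set.inter_eq_right.2 hAs]
      · change mul (idOn _) (idOn _) = idOn _
        rw [idOn_mul_idOn, Set.inter_self]
      · change χ.ev (dom (idOn (dom s.1)))
        rw [dom_idOn]
        exact h
    · rintro p q ⟨h, e, he, hχ, hpq⟩
      exact ⟨h.symm, e, he, h ▸ hχ, hpq.symm⟩
    · rintro p q r ⟨h, e, he, hχ, hpq⟩ ⟨h', e', he', hχ', hqr⟩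
      refine ⟨h.trans h', ?_⟩
      obtain ⟨g, hg, hgm, hgd⟩ := he.inter he'
      obtain ⟨g', hg', hgm', hgd'⟩ := he'.inter he
      have hgg : g.1 = g'.1 := by
        rw [eq_idOn_of_mul_self hg, eq_idOn_of_mul_self hg', hgd, hgd', Set.inter_comm]
      refine ⟨g, hg, ?_, ?_⟩
      · rw [hgd, Omega.ev_inter _ (IBar.dom_mem e.2) (IBar.dom_mem e'.2)]
        exact ⟨hχ, h ▸ hχ'⟩
      · have assoc : ∀ a b c : Mor C ≃. Mor C, mul a (mul b c) = mul (mul a b) c :=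
          fun a b c => PEquiv.trans_assoc c b a
        calc mul p.1.1.1 g.1 = mul (mul p.1.1.1 e.1) e'.1 := by rw [hgm, assoc]
          _ = mul q.1.1.1 g.1 := by rw [hpq, hgm, assoc]
          _ = mul (mul q.1.1.1 e'.1) e.1 := by rw [hgg, hgm', assoc]
          _ = mul r.1.1.1 g.1 := by rw [hqr, hgg, hgm', assoc]

/-- The transformation groupoid of `C`, as the set of its elements: all germs `[s, χ]`. -/
def G : Type (max u v) := Quotient (germSetoid C)

end

section

variable {C : Type u} [Category.{v} C] [LeftCancellativeCategory C]

/-- The germ `[s, χ]`. -/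
def germ (s : IBar C) (χ : Omega C) (h : χ ∈ D s) : G C :=
  Quotient.mk (germSetoid C) ⟨(s, χ), h⟩

/-- The source of a germ: the source of `[s, χ]` is `χ`. -/
def G.source (g : G C) : Omega C :=
  Quotient.lift (s := germSetoid C) (fun p : Pair C => p.1.2) (fun _ _ h => h.1) g

/-- The target of a germ: the target of `[s, χ]` is `s · χ`. -/
noncomputable def G.target (g : G C) : Omega C :=
  Quotient.lift (s := germSetoid C) (fun p : Pair C => act p.1.1 p.1.2 p.2) (by
    rintro ⟨⟨s, χ⟩, hs⟩ ⟨⟨t, ψ⟩, ht⟩ ⟨h, e, he, hχ, hst⟩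
    change χ = ψ at h
    subst h
    change χ.ev (dom e.1) at hχ
    change mul s.1 e.1 = mul t.1 e.1 at hst
    apply Omega.ext
    funext f
    have key : χ.ev (preimage s.1 f) ↔ χ.ev (preimage t.1 f) := by
      have e1 := χ.ev_inter (IBar.preimage_mem s.2 f) (IBar.dom_mem e.2)
      have e2 := χ.ev_inter (IBar.preimage_mem t.2 f) (IBar.dom_mem e.2)
      have e3 : preimage s.1 (f : Set (Mor C)) ∩ dom e.1 = preimage t.1 f ∩ dom e.1 := by
        apply Set.Subset.antisymm
        · exact fun x hx => ⟨preimage_inter_dom he hst _ hx, hx.2⟩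
        · exact fun x hx => ⟨preimage_inter_dom he hst.symm _ hx, hx.2⟩
      rw [e3, e2] at e1
      constructor
      · intro h
        exact (e1.2 ⟨h, hχ⟩).1
      · intro h
        exact (e1.1 ⟨h, hχ⟩).1
    classical
    exact decide_eq_decide.2 key) g

/-- The topology with the basic open sets `{[s, χ] | χ ∈ U}`, where `U` is an open subset of the
domain of the action of `s`. -/
instance : TopologicalSpace (G C) :=
  TopologicalSpace.generateFrom
    {W | ∃ (s : IBar C) (U : Set (Omega C)) (hU : U ⊆ D s), IsOpen U ∧
      W = {g | ∃ (χ : Omega C) (h : χ ∈ U), g = germ s χ (hU h)}}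

end

section

variable (C : Type u) [Category.{v} C] [LeftCancellativeCategory C]

/-- The isotropy of the transformation groupoid: all elements whose source equals the target. -/
def isotropy : Set (G C) := {g | g.source = g.target}

end

/-! ## Principal characters -/

section

variable {C : Type u} [Category.{v} C] [LeftCancellativeCategory C]

/-- Elements of the inverse hull commute with right multiplication. -/
theorem InverseHull.right_mul {s : Mor C ≃. Mor C} (hs : InverseHull C s) :
    ∀ {X Y : C} (x : X ⟶ Y) (b : Mor C), b ∈ s (Arrow.mk x) →
      ∃ (Z : C) (y : X ⟶ Z), b = Arrow.mk y ∧
        ∀ {W : C} (q : W ⟶ X), Arrow.mk (q ≫ y) ∈ s (Arrow.mk (q ≫ x)) := by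
  induction hs with
  | leftMul c =>
    intro X Y x b hb
    obtain ⟨X', x', hx, rfl⟩ := mem_leftMul.1 hb
    obtain ⟨rfl, rfl, hxx⟩ := mk_eq_mk hx
    simp only [eqToHom_refl, Category.comp_id, Category.id_comp] at hxx
    subst hxx
    refine ⟨_, x ≫ c, rfl, fun q => mem_leftMul.2 ⟨_, q ≫ x, rfl, ?_⟩⟩
    rw [Category.assoc]
  | mul _ _ ihs iht =>
    intro X Y x b hb
    obtain ⟨a, ha, hb⟩ := mem_mul.1 hb
    obtain ⟨Z, y, rfl, hy⟩ := iht x a ha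
    obtain ⟨Z', z, rfl, hz⟩ := ihs y b hb
    exact ⟨Z', z, rfl, fun q => mem_mul.2 ⟨_, hy q, hz q⟩⟩
  | symm _ ih =>
    intro X Y x b hb
    rw [mem_symm] at hb
    obtain ⟨Z, y, hy, hq⟩ := ih b.hom (Arrow.mk x) hb
    obtain ⟨rfl, rfl, hxy⟩ := mk_eq_mk hy
    simp only [eqToHom_refl, Category.comp_id, Category.id_comp] at hxy
    subst hxy
    exact ⟨_, b.hom, rfl, fun q => mem_symm.2 (hq q)⟩

/-- Elements of `E` are right ideals. -/
theorem E.right_mul (e : E C) {W X Y : C} (x : X ⟶ Y) (h : Arrow.mk x ∈ (e : Set (Mor C)))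
    (q : W ⟶ X) : Arrow.mk (q ≫ x) ∈ (e : Set (Mor C)) := by
  obtain ⟨Z, y, _, hq⟩ := InverseHull.right_mul e.2 x _ (mem_idOn.2 ⟨h, rfl⟩)
  exact (mem_idOn.1 (hq q)).1

/-- The idempotent `c c⁻¹`. -/
noncomputable def rangeE (c : Mor C) : E C :=
  domE (InverseHull.symm (InverseHull.leftMul c.hom))

theorem rangeE_subset (c : Mor C) (e : E C) :
    (rangeE c : Set (Mor C)) ⊆ e ↔ c ∈ (e : Set (Mor C)) := by
  constructor
  · intro h
    apply h
    refine ⟨Arrow.mk (𝟙 c.left), mem_symm.2 (mem_leftMul.2 ⟨_, 𝟙 c.left, rfl, ?_⟩)⟩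
    rw [Category.id_comp]
    rfl
  · rintro h x ⟨y, hy⟩
    obtain ⟨X, z, rfl, rfl⟩ := mem_leftMul.1 (mem_symm.1 hy)
    exact e.right_mul c.hom h z

open Classical in
/-- The principal character `χ_c`, with `χ_c(e) = 1` if and only if `c c⁻¹ ≤ e`. -/
noncomputable def principal (c : Mor C) : Omega C :=
  { toFun := fun e => decide ((rangeE c : Set (Mor C)) ⊆ e)
    nonzero := ⟨rangeE c, by simp⟩
    map_inter := by
      intro e f
      rw [← Bool.decide_and, decide_eq_decide]
      exact Set.subset_inter_iff
    map_join := by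
      intro f l hfl
      simp only [decide_eq_true_eq, rangeE_subset]
      rw [hfl]
      simp only [Set.mem_iUnion, exists_prop] }

/-- The element `c u c⁻¹` of the inverse hull, for an invertible morphism `u` from the source of
`c` to itself. -/
noncomputable def conjUnit (c : Mor C) (u : c.left ≅ c.left) : IBar C :=
  ⟨mul (leftMul c.hom) (mul (leftMul u.hom) (leftMul c.hom).symm),
    IBar_of_hull (InverseHull.mul (InverseHull.leftMul _)
      (InverseHull.mul (InverseHull.leftMul _) (InverseHull.symm (InverseHull.leftMul _))))⟩

/-- The extended principal character `χ_c` takes the value `1` exactly at those elements of the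
Boolean closure that contain `c`. -/
theorem principal_ev (c : Mor C) {A : Set (Mor C)} (hA : A ∈ EBar C) :
    (principal c).ev A ↔ c ∈ A := by
  obtain ⟨l, rfl⟩ := hA
  rw [Omega.ev_toSet]
  unfold BoolExpr.Holds BoolExpr.toSet
  simp only [principal, decide_eq_true_eq, decide_eq_false_iff_not, rangeE_subset]
  rfl

theorem principal_mem_D {s : IBar C} {c : Mor C} (h : c ∈ dom s.1) : principal c ∈ D s :=
  (principal_ev c (IBar.dom_mem s.2)).2 h

theorem principal_mem_D_conjUnit (c : Mor C) (u : c.left ≅ c.left) :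
    principal c ∈ D (conjUnit c u) := by
  apply principal_mem_D
  refine ⟨Arrow.mk (u.hom ≫ c.hom), mem_mul.2 ⟨Arrow.mk u.hom, mem_mul.2 ⟨Arrow.mk (𝟙 c.left), ?_, ?_⟩,
    mem_leftMul.2 ⟨_, u.hom, rfl, rfl⟩⟩⟩
  · refine mem_symm.2 (mem_leftMul.2 ⟨_, 𝟙 _, rfl, ?_⟩)
    rw [Category.id_comp]
    rfl
  · refine mem_leftMul.2 ⟨_, 𝟙 _, rfl, ?_⟩
    rw [Category.id_comp]

end

end LCSC

/-! Everything rests on testing at principal characters. For `A` in the Boolean closure of `E`, the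
value of `χ_c` at `A` is `1` exactly when `c ∈ A`, so a statement about all `χ_c` with `c ∈ A` is a
statement about the points of the set `A`.

Locally, `[s, χ_c]` is isotropic iff, for every `f ∈ E`, `s c ∈ f` is equivalent to `c ∈ f`. Taking
for `f` the principal right ideals of `c` and of `s c` shows that these coincide. Both morphisms
have the same source, so left cancellation gives `s c = c u` with `u` invertible, and since `s`
commutes with right multiplication it agrees with `c u c⁻¹` near `χ_c`. Hence condition 3 says
precisely that `[s, χ_c]` is isotropic for each `c ∈ dom e` (`germ_principal_mem_isotropy_iff`).

If `[s, χ]` is interior, a neighbourhood of the form `{[s, ψ] | ψ(A) = 1}` lies in the isotropy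
(`exists_ev_of_germ_mem_open`), and `e = A` works. Conversely, condition 3 yields the equality of
sets `s⁻¹(f) ∩ dom e = f ∩ dom e` for every `f ∈ E`. Each `ψ ∈ Ω` is well defined and multiplicative
on the Boolean closure, so `ψ(e) = 1` forces `ψ(s⁻¹ f s) = ψ(f)`. Thus the open set `{[s, ψ] | ψ(e)
= 1}` is isotropic. This set equality takes the place of a density argument. -/

namespace PBij

/-! ### Restricting partial bijections to idempotents -/

variable {α : Type w}

theorem isIdem_idOn (A : Set α) : mul (idOn A) (idOn A) = idOn A := by
  rw [idOn_mul_idOn, Set.inter_self]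

theorem mem_mul_idOn {s : α ≃. α} {A : Set α} {x y : α} :
    y ∈ mul s (idOn A) x ↔ x ∈ A ∧ y ∈ s x := by
  rw [mem_mul]
  constructor
  · rintro ⟨z, hz, hy⟩
    obtain ⟨hx, rfl⟩ := mem_idOn.1 hz
    exact ⟨hx, hy⟩
  · rintro ⟨hx, hy⟩
    exact ⟨x, mem_idOn.2 ⟨hx, rfl⟩, hy⟩

/-- The order relation `e ≤ s⁻¹ s` for an idempotent `e` is inclusion of domains. -/
theorem idOn_le_symm_mul_iff {s : α ≃. α} {A : Set α} :
    idOn A ≤ mul s.symm s ↔ A ⊆ dom s := by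
  rw [symm_mul]
  constructor
  · intro h x hx
    exact (mem_idOn.1 (h x x (mem_idOn.2 ⟨hx, rfl⟩))).1
  · intro h x y hxy
    obtain ⟨hx, rfl⟩ := mem_idOn.1 hxy
    exact mem_idOn.2 ⟨h hx, rfl⟩

end PBij

namespace LCSC

open PBij

variable {C : Type u} [Category.{v} C] [LeftCancellativeCategory C]

/-! ## The topology of the space of characters -/

theorem Omega.isOpen_setOf_toFun_eq (e : E C) (b : Bool) :
    IsOpen {χ : Omega C | χ.toFun e = b} := by
  have h : Continuous fun χ : Omega C => χ.toFun e :=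
    (continuous_apply e).comp continuous_induced_dom
  exact (isOpen_discrete {b}).preimage h

/-- Any expression for `A` computes the value at `A`, and a fixed expression involves only finitely
many coordinates of the character. -/
theorem Omega.isOpen_setOf_ev {A : Set (Mor C)} (hA : A ∈ EBar C) :
    IsOpen {χ : Omega C | χ.ev A} := by
  obtain ⟨l, rfl⟩ := hA
  have : {χ : Omega C | χ.ev l.toSet} = ⋃ p ∈ {p | p ∈ l.1},
      {χ : Omega C | χ.toFun p.1 = true} ∩
        ⋂ f ∈ {f | f ∈ p.2}, {χ : Omega C | χ.toFun f = false} := by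
    ext χ
    simp only [Set.mem_ofPred_eq, Omega.ev_toSet, BoolExpr.Holds, Set.mem_iUnion, Set.mem_inter_iff,
      Set.mem_iInter, exists_prop]
  rw [this]
  exact isOpen_biUnion fun p _ => (isOpen_setOf_toFun_eq _ _).inter
    ((List.finite_toSet p.2).isOpen_biInter fun f _ => isOpen_setOf_toFun_eq _ _)

theorem isOpen_D (s : IBar C) : IsOpen (D s) :=
  Omega.isOpen_setOf_ev (IBar.dom_mem s.2)

/-- The relative complement `e \ f` as an element of the Boolean closure. -/
def BoolExpr.diff (e f : E C) : BoolExpr C :=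
  -- Subtracted elements must lie below `e`, so `f` is replaced by its intersection with `e`.
  ⟨[(e, [e.inter f])], by
    intro p hp g hg
    obtain rfl := List.mem_singleton.1 hp
    obtain rfl := List.mem_singleton.1 hg
    exact Set.inter_subset_left⟩

theorem BoolExpr.holds_diff (e f : E C) (χ : Omega C) :
    (BoolExpr.diff e f).Holds χ ↔ χ.toFun e = true ∧ χ.toFun f = false := by
  simp +contextual [BoolExpr.Holds, BoolExpr.diff, χ.map_inter]

/-- Finitely many coordinates of a character can be fixed by one element of the Boolean closure. The
value `1` at `e` is enforced by `e` itself, and the value `0` by `e₀ \ e` with `χ(e₀) = 1`. Some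
such `e₀` is needed because `E` may have no largest element, so that `e` has only relative
complements. -/
theorem Omega.exists_ev_forall_eqOn (χ : Omega C) (I : Finset (E C)) :
    ∃ A ∈ EBar C, χ.ev A ∧ ∀ ψ : Omega C, ψ.ev A → ∀ e ∈ I, ψ.toFun e = χ.toFun e := by
  classical
  obtain ⟨e₀, he₀⟩ := χ.nonzero
  induction I using Finset.induction_on with
  | empty => exact ⟨e₀, e₀.mem_EBar, (χ.ev_coe e₀).2 he₀, by simp⟩
  | insert e I _ ih =>
    obtain ⟨A, hA, hχA, hI⟩ := ih
    suffices ∃ B ∈ EBar C, χ.ev B ∧ ∀ ψ : Omega C, ψ.ev B → ψ.toFun e = χ.toFun e by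
      obtain ⟨B, hB, hχB, he⟩ := this
      refine ⟨A ∩ B, EBar_inter hA hB, (χ.ev_inter hA hB).2 ⟨hχA, hχB⟩, fun ψ hψ f hf => ?_⟩
      obtain ⟨hψA, hψB⟩ := (ψ.ev_inter hA hB).1 hψ
      rcases Finset.mem_insert.1 hf with rfl | hf
      · exact he ψ hψB
      · exact hI ψ hψA f hf
    cases hχe : χ.toFun e with
    | true => exact ⟨e, e.mem_EBar, (χ.ev_coe e).2 hχe, fun ψ hψ => (ψ.ev_coe e).1 hψ⟩
    | false =>
      exact ⟨_, ⟨BoolExpr.diff e₀ e, rfl⟩,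
        (χ.ev_toSet _).2 ((BoolExpr.holds_diff _ _ _).2 ⟨he₀, hχe⟩),
        fun ψ hψ => ((BoolExpr.holds_diff _ _ _).1 ((ψ.ev_toSet _).1 hψ)).2⟩

/-- The sets `{ψ | ψ(A) = 1}`, for `A` in the Boolean closure of `E`, form a basis of `Ω`. -/
theorem Omega.exists_ev_subset {U : Set (Omega C)} (hU : IsOpen U) {χ : Omega C} (hχ : χ ∈ U) :
    ∃ A ∈ EBar C, χ.ev A ∧ {ψ : Omega C | ψ.ev A} ⊆ U := by
  obtain ⟨V, hV, rfl⟩ := isOpen_induced_iff.1 hU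
  obtain ⟨I, u, hu, hIV⟩ := isOpen_pi_iff.1 hV _ hχ
  obtain ⟨A, hA, hχA, hI⟩ := χ.exists_ev_forall_eqOn I
  refine ⟨A, hA, hχA, fun ψ hψ => hIV fun e he => ?_⟩
  rw [hI ψ hψ e he]
  exact (hu e he).2

/-! ## Germs -/

theorem germ_eq_germ_iff {s t : IBar C} {χ ψ : Omega C} {hs : χ ∈ D s} {ht : ψ ∈ D t} :
    germ s χ hs = germ t ψ ht ↔
      χ = ψ ∧ ∃ e : IBar C, IsIdem e ∧ χ.ev (dom e.1) ∧ mul s.1 e.1 = mul t.1 e.1 :=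
  Quotient.eq (r := germSetoid C)

/-- A character is determined by its values on `E`, and the value of `s · χ` at `f` is by definition
that of `χ` at `s⁻¹ f s`. -/
theorem mem_isotropy_germ_iff {s : IBar C} {χ : Omega C} {h : χ ∈ D s} :
    germ s χ h ∈ isotropy C ↔ ∀ f : E C, χ.ev (preimage s.1 f) ↔ χ.ev f := by
  classical
  change χ = act s χ h ↔ _
  rw [Omega.ext_iff, funext_iff]
  refine forall_congr' fun f => ?_
  change χ.toFun f = decide (χ.ev (preimage s.1 f)) ↔ _
  rw [Bool.eq_iff_iff, decide_eq_true_iff, χ.ev_coe]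
  exact Iff.comm

theorem isOpen_setOf_germ (s : IBar C) {U : Set (Omega C)} (hU : U ⊆ D s) (hUo : IsOpen U) :
    IsOpen {g | ∃ (χ : Omega C) (h : χ ∈ U), g = germ s χ (hU h)} :=
  TopologicalSpace.isOpen_generateFrom_of_mem ⟨s, U, hU, hUo, rfl⟩

/-- An idempotent `e` witnessing `[s, χ] = [t, χ]` also witnesses `[s, φ] = [t, φ]` for every `φ` in
the domains of both `s` and `t` with `φ(e) = 1`, which is an open condition. -/
theorem continuous_germ (s : IBar C) : Continuous fun χ : D s => germ s χ.1 χ.2 := by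
  refine continuous_generateFrom_iff.2 ?_
  rintro _ ⟨t, U, hU, hUo, rfl⟩
  rw [isOpen_iff_forall_mem_open]
  rintro ⟨χ, hχ⟩ ⟨ψ, hψ, hg⟩
  obtain ⟨rfl, e, he, hχe, hst⟩ := germ_eq_germ_iff.1 hg
  refine ⟨Subtype.val ⁻¹' (U ∩ {ψ | ψ.ev (dom e.1)}), ?_,
    (hUo.inter (Omega.isOpen_setOf_ev (IBar.dom_mem e.2))).preimage continuous_subtype_val,
    hψ, hχe⟩
  rintro ⟨φ, hφ⟩ ⟨hφU, hφe⟩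
  exact ⟨φ, hφU, germ_eq_germ_iff.2 ⟨rfl, e, he, hφe, hst⟩⟩

/-- Pulling `W` back along the continuous map `χ ↦ [s, χ]` keeps the given representative `s`, and
it avoids having to show that the generating sets form a basis. -/
theorem exists_ev_of_germ_mem_open {W : Set (G C)} (hW : IsOpen W) {s : IBar C} {χ : Omega C}
    {h : χ ∈ D s} (hg : germ s χ h ∈ W) :
    ∃ A ∈ EBar C, A ⊆ dom s.1 ∧ χ.ev A ∧
      ∀ (ψ : Omega C) (hψ : ψ ∈ D s), ψ.ev A → germ s ψ hψ ∈ W := by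
  obtain ⟨U, hU, hUW⟩ := isOpen_induced_iff.1 (hW.preimage (continuous_germ s))
  have hχU : (⟨χ, h⟩ : D s) ∈ Subtype.val ⁻¹' U := by
    rw [hUW]
    exact hg
  obtain ⟨A, hA, hχA, hAU⟩ := Omega.exists_ev_subset hU hχU
  have hs := IBar.dom_mem s.2
  -- Cutting down to `dom s` makes this set the domain of an idempotent below `s⁻¹ s`.
  refine ⟨A ∩ dom s.1, EBar_inter hA hs, Set.inter_subset_right, (χ.ev_inter hA hs).2 ⟨hχA, h⟩,
    fun ψ hψ hψA => ?_⟩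
  have : (⟨ψ, hψ⟩ : D s) ∈ Subtype.val ⁻¹' U := hAU ((ψ.ev_inter hA hs).1 hψA).1
  rwa [hUW] at this

/-! ## Elements of the enlarged inverse hull -/

/-- The bound by a domain is used because an element of the enlarged hull restricts a single element
of `I_l`, here `s⁻¹ s`, whereas a set in the Boolean closure is only covered by finitely many
elements of `E`. -/
theorem idOn_mem_IBar {A : Set (Mor C)} (hA : A ∈ EBar C) {s : IBar C} (h : A ⊆ dom s.1) :
    idOn A ∈ IBar C := by
  obtain ⟨_, s, hs, B, hB, hBs, rfl⟩ := s
  rw [dom_mul_idOn hBs] at h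
  refine ⟨mul s.symm s, InverseHull.mul hs.symm hs, A, hA, ?_, ?_⟩
  · rw [symm_mul, dom_idOn]
    exact h.trans hBs
  · rw [symm_mul, idOn_mul_idOn, Set.inter_eq_right.2 (h.trans hBs)]

/-- Elements of the enlarged inverse hull preserve the source and commute with right
multiplication wherever both sides are defined. -/
theorem IBar.exists_hom {s : Mor C ≃. Mor C} (hs : s ∈ IBar C) {X Y : C} {x : X ⟶ Y}
    (hx : Arrow.mk x ∈ dom s) : ∃ (Z : C) (y : X ⟶ Z), Arrow.mk y ∈ s (Arrow.mk x) ∧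
      ∀ {W : C} (q : W ⟶ X), Arrow.mk (q ≫ x) ∈ dom s →
        Arrow.mk (q ≫ y) ∈ s (Arrow.mk (q ≫ x)) := by
  obtain ⟨s, hs, A, hA, hAs, rfl⟩ := hs
  obtain ⟨b, hb⟩ := hx
  obtain ⟨hxA, hb⟩ := mem_mul_idOn.1 hb
  obtain ⟨Z, y, rfl, hy⟩ := hs.right_mul x b hb
  -- Because of the set differences, `A` need not be a right ideal, so membership of `q ≫ x` in the
  -- domain has to be assumed.
  refine ⟨Z, y, mem_mul_idOn.2 ⟨hxA, hb⟩, fun q hq => ?_⟩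
  rw [dom_mul_idOn hAs] at hq
  exact mem_mul_idOn.2 ⟨hq, hy q⟩

theorem mem_rangeE {c a : Mor C} :
    a ∈ (rangeE c : Set (Mor C)) ↔ ∃ (X : C) (x : X ⟶ c.left), a = Arrow.mk (x ≫ c.hom) := by
  constructor
  · rintro ⟨y, hy⟩
    obtain ⟨X, x, _, rfl⟩ := mem_leftMul.1 (mem_symm.1 hy)
    exact ⟨X, x, rfl⟩
  · rintro ⟨X, x, rfl⟩
    exact ⟨Arrow.mk x, mem_symm.2 (mem_leftMul.2 ⟨X, x, rfl, rfl⟩)⟩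

theorem self_mem_rangeE (c : Mor C) : c ∈ (rangeE c : Set (Mor C)) :=
  (rangeE_subset c _).1 subset_rfl

theorem mem_conjUnit {c : Mor C} {u : c.left ≅ c.left} {a b : Mor C} :
    b ∈ (conjUnit c u).1 a ↔
      ∃ (X : C) (x : X ⟶ c.left), a = Arrow.mk (x ≫ c.hom) ∧ b = Arrow.mk (x ≫ u.hom ≫ c.hom) := by
  constructor
  · intro h
    obtain ⟨y, hy, hb⟩ := mem_mul.1 h
    obtain ⟨z, hz, hzy⟩ := mem_mul.1 hy
    obtain ⟨X, x, rfl, rfl⟩ := mem_leftMul.1 (mem_symm.1 hz)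
    refine ⟨X, x, rfl, ?_⟩
    have hy' : Arrow.mk (x ≫ u.hom) ∈ leftMul u.hom (Arrow.mk x) := mem_leftMul.2 ⟨X, x, rfl, rfl⟩
    obtain rfl := mem_unique hzy hy'
    refine mem_unique hb (mem_leftMul.2 ⟨X, x ≫ u.hom, rfl, ?_⟩)
    rw [Category.assoc]
  · rintro ⟨X, x, rfl, rfl⟩
    refine mem_mul.2 ⟨Arrow.mk (x ≫ u.hom), mem_mul.2 ⟨Arrow.mk x, ?_, ?_⟩, ?_⟩
    · exact mem_symm.2 (mem_leftMul.2 ⟨X, x, rfl, rfl⟩)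
    · exact mem_leftMul.2 ⟨X, x, rfl, rfl⟩
    · exact mem_leftMul.2 ⟨X, x ≫ u.hom, rfl, by rw [Category.assoc]⟩

/-! ## Isotropy at principal characters -/

/-- Two morphisms with the same source that generate the same right ideal differ by an
automorphism of the source. -/
theorem exists_iso_of_mem_rangeE {X Y Z : C} {x : X ⟶ Y} {y : X ⟶ Z}
    (h₁ : Arrow.mk y ∈ (rangeE (Arrow.mk x) : Set (Mor C)))
    (h₂ : Arrow.mk x ∈ (rangeE (Arrow.mk y) : Set (Mor C))) :
    ∃ u : X ≅ X, Arrow.mk y = Arrow.mk (u.hom ≫ x) := by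
  obtain ⟨W, p, hp⟩ := mem_rangeE.1 h₁
  obtain ⟨V, q, hq⟩ := mem_rangeE.1 h₂
  change W ⟶ X at p
  change V ⟶ X at q
  change Arrow.mk y = Arrow.mk (p ≫ x) at hp
  change Arrow.mk x = Arrow.mk (q ≫ y) at hq
  obtain ⟨rfl, rfl, hp⟩ := mk_eq_mk hp
  obtain ⟨rfl, _, hq⟩ := mk_eq_mk hq
  simp only [eqToHom_refl, Category.comp_id, Category.id_comp] at hp hq
  -- With `y = p ≫ x` and `x = q ≫ y`, cancelling `y` and then `x` shows that `p` and `q` are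
  -- mutually inverse.
  have hpq : p ≫ q = 𝟙 _ := LeftCancellativeCategory.left_cancel y _ _ <| by
    rw [Category.assoc, ← hq, ← hp, Category.id_comp]
  have hqp : q ≫ p = 𝟙 _ := LeftCancellativeCategory.left_cancel x _ _ <| by
    rw [Category.assoc, ← hp, ← hq, Category.id_comp]
  exact ⟨⟨p, q, hpq, hqp⟩, by rw [hp]⟩

/-- This turns condition 3 into isotropy at `χ_c`: isotropy forces `c` and `s c` to generate the
same right ideal, and `s c = c u` in turn puts `c` and `s c` in the same elements of `E`. -/
theorem germ_principal_mem_isotropy_iff {s : IBar C} {c : Mor C} (hc : principal c ∈ D s) :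
    germ s (principal c) hc ∈ isotropy C ↔ ∃ u : c.left ≅ c.left,
      germ s (principal c) hc = germ (conjUnit c u) (principal c)
        (principal_mem_D_conjUnit c u) := by
  have hcs : c ∈ dom s.1 := (principal_ev c (IBar.dom_mem s.2)).1 hc
  rw [mem_isotropy_germ_iff]
  simp only [principal_ev c (IBar.preimage_mem s.2 _), principal_ev c (E.mem_EBar _)]
  constructor
  · intro H
    obtain ⟨Z, y, hy, hq⟩ := IBar.exists_hom s.2 (x := c.hom) hcs
    -- Testing with the right ideal generated by `c` gives `s c ∈ c C`; testing below with the one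
    -- generated by `s c` gives `c ∈ (s c) C`.
    obtain ⟨_, hy', h₁⟩ := (H (rangeE c)).2 (self_mem_rangeE c)
    obtain rfl := mem_unique hy hy'
    obtain ⟨u, hu⟩ := exists_iso_of_mem_rangeE h₁ ((H _).1 ⟨_, hy, self_mem_rangeE _⟩)
    obtain ⟨_, rfl, hyu⟩ := mk_eq_mk hu
    simp only [eqToHom_refl, Category.comp_id, Category.id_comp] at hyu
    subst hyu
    -- The germs agree on `c C ∩ dom s`: there `s (c x) = c u x`. The intersection is needed since
    -- `dom s` need not contain all of `c C`.
    have hA := EBar_inter (rangeE c).mem_EBar (IBar.dom_mem s.2)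
    refine ⟨u, germ_eq_germ_iff.2 ⟨rfl, ⟨idOn _, idOn_mem_IBar hA Set.inter_subset_right⟩,
      isIdem_idOn _, ?_, ?_⟩⟩
    · rw [dom_idOn, principal_ev c hA]
      exact ⟨self_mem_rangeE c, hcs⟩
    · apply ext_mem
      intro a b
      rw [mem_mul_idOn, mem_mul_idOn]
      refine and_congr_right fun ⟨ha, has⟩ => ?_
      obtain ⟨X, x, rfl⟩ := mem_rangeE.1 ha
      have h₁ := hq x has
      have h₂ : Arrow.mk (x ≫ u.hom ≫ c.hom) ∈ (conjUnit c u).1 (Arrow.mk (x ≫ c.hom)) :=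
        mem_conjUnit.2 ⟨X, x, rfl, rfl⟩
      exact ⟨fun h => mem_unique h h₁ ▸ h₂, fun h => mem_unique h h₂ ▸ h₁⟩
  · rintro ⟨u, hu⟩ f
    obtain ⟨-, e, he, hce, hsu⟩ := germ_eq_germ_iff.1 hu
    rw [eq_idOn_of_mul_self he] at hsu
    have hce : c ∈ dom e.1 := (principal_ev c (IBar.dom_mem e.2)).1 hce
    have hcu : Arrow.mk (u.hom ≫ c.hom) ∈ (conjUnit c u).1 c :=
      mem_conjUnit.2 ⟨_, 𝟙 _, by rw [Category.id_comp]; rfl, by rw [Category.id_comp]⟩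
    -- The idempotent witnessing equality of germs at `χ_c` contains `c`, so the two maps agree at
    -- `c` itself: `s c = c u`.
    have hsc : Arrow.mk (u.hom ≫ c.hom) ∈ s.1 c := by
      have := mem_mul_idOn.2 ⟨hce, hcu⟩
      rw [← hsu] at this
      exact (mem_mul_idOn.1 this).2
    constructor
    · rintro ⟨y, hy, hyf⟩
      obtain rfl := mem_unique hy hsc
      -- `c = (c u) u⁻¹`, and `f` is a right ideal.
      have := f.right_mul _ hyf u.inv
      rwa [Iso.inv_hom_id_assoc] at this
    · intro hf
      exact ⟨_, hsc, f.right_mul c.hom hf u.hom⟩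

end LCSC

/-! ### The interior of the isotropy -/

theorem mainTheorem9 {C : Type u} [Category.{v} C] [LeftCancellativeCategory C]
    (s : LCSC.IBar C) (χ : LCSC.Omega C) (h : χ ∈ LCSC.D s) :
    LCSC.germ s χ h ∈ interior (LCSC.isotropy C) ↔
      ∃ e : LCSC.IBar C, LCSC.IsIdem e ∧ e.1 ≤ PBij.mul s.1.symm s.1 ∧ χ.ev (PBij.dom e.1) ∧
        ∀ c ∈ PBij.dom e.1, ∃ (hc : LCSC.principal c ∈ LCSC.D s) (u : c.left ≅ c.left),
          LCSC.germ s (LCSC.principal c) hc =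
            LCSC.germ (LCSC.conjUnit c u) (LCSC.principal c)
              (LCSC.principal_mem_D_conjUnit c u) := by
  open LCSC PBij in
  constructor
  · intro hg
    obtain ⟨A, hA, hAs, hχA, hAW⟩ := exists_ev_of_germ_mem_open isOpen_interior hg
    refine ⟨⟨idOn A, idOn_mem_IBar hA hAs⟩, isIdem_idOn A, idOn_le_symm_mul_iff.2 hAs, ?_, ?_⟩
    · rwa [dom_idOn]
    · intro c hc
      rw [dom_idOn] at hc
      have hcs := principal_mem_D (hAs hc)
      exact ⟨hcs, (germ_principal_mem_isotropy_iff hcs).1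
        (interior_subset (hAW _ hcs ((principal_ev c hA).2 hc)))⟩
  · rintro ⟨e, he, hes, hχe, H⟩
    have hE := IBar.dom_mem e.2
    rw [eq_idOn_of_mul_self he, idOn_le_symm_mul_iff] at hes
    have hsub : {ψ : Omega C | ψ.ev (dom e.1)} ⊆ D s := fun ψ hψ => by
      rw [Set.mem_ofPred_eq, ← Set.inter_eq_left.2 hes, ψ.ev_inter hE (IBar.dom_mem s.2)] at hψ
      exact hψ.2
    refine mem_interior.2 ⟨_, ?_, isOpen_setOf_germ s hsub (Omega.isOpen_setOf_ev hE),
      χ, hχe, rfl⟩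
    rintro _ ⟨ψ, hψ, rfl⟩
    refine mem_isotropy_germ_iff.2 fun f => ?_
    -- Condition 3, read at each `c ∈ dom e`, says that `c` lies in `s⁻¹(f)` iff it lies in `f`.
    -- This passes from principal characters to all `ψ` with `ψ(e) = 1`.
    have hf : preimage s.1 f ∩ dom e.1 = (f : Set (Mor C)) ∩ dom e.1 := by
      ext c
      refine and_congr_left fun hc => ?_
      obtain ⟨hcs, u, hu⟩ := H c hc
      have := mem_isotropy_germ_iff.1 ((germ_principal_mem_isotropy_iff hcs).2 ⟨u, hu⟩) f
      rwa [principal_ev c (IBar.preimage_mem s.2 f), principal_ev c f.mem_EBar] at this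
    -- Evaluate `ψ` on both sides of `hf`; since `ψ(e) = 1`, the factor `dom e` drops out.
    have h₁ := ψ.ev_inter (IBar.preimage_mem s.2 f) hE
    rw [hf, ψ.ev_inter f.mem_EBar hE] at h₁
    exact ⟨fun h => (h₁.2 ⟨h, hψ⟩).1, fun h => (h₁.1 ⟨h, hψ⟩).1⟩
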